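/- **Theorem.** Let $m\ge 1$ be an integer. For a real number $q>1$ let $$\Gamma_{q,m}=\Big\{\sum_{i=1}^{\infty}\frac{c_i}{q^i} : c_i\in\{0,1,\ldots,m\}\Big\},$$ and let $\mathcal U_{m,m}(q)$ be the set of real numbers $t$ for which there is exactly one sequence $(t_i)_{i\ge1}$ in $\{-m,\ldots,-1,0,1,\ldots,m\}$ with $t=\sum_{i=1}^{\infty}t_i/q^i$. A *self-similar set* is a nonempty compact set $E\subset\mathbb R$ with $E=\bigcup_{j=1}^n f_j(E)$ for finitely many contracting similarities $f_1,\ldots,f_n$ of $\mathbb R$, that is, maps with $|f_j(x)-f_j(y)|=r_j|x-y|$ for all $x,y\in\mathbb R$, where $0<r_j<1$. Put $$\mathcal S_{m,m}(q)=\{t\in\mathcal U_{m,m}(q) : \Gamma_{q,m}\cap(\Gamma_{q,m}+t)\text{ is a self-similar set}\},$$ $$\mathcal H_{m,m}(q)=\{\dim_H(\Gamma_{q,m}\cap(\Gamma_{q,m}+t)) : t\in\mathcal S_{m,m}(q)\},$$ where $\dim_H$ denotes the Hausdorff dimension, and $$c_1=\frac{\log m}{\log q},\qquad c_2=\frac{\log(m+1)}{\log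 q},\qquad q_c=\frac{m+2+\sqrt{m(m+4)}}{2}.$$ (i) If $q\ge q_c$, then $\mathcal H_{m,m}(q)$ is dense in $[c_1,c_2]$, that is, $\mathcal H_{m,m}(q)\cap[c_1,c_2]$ is a dense subset of $[c_1,c_2]$. (ii) If $m+1<q<q_c$, then there exists a $\delta>0$ such that $\mathcal H_{m,m}(q)\cap(c_2-\delta,c_2)=\varnothing$. -/

import Mathlib

namespace CantorIntersection

/-- `c 0, c 1, …` is an expansion of `x` in base `q` over the (integer) alphabet `Ω`:
all digits lie in `Ω` and `x = ∑ c i / q ^ (i + 1)`. The sequence is indexed from `0`, so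
`c i` is the digit usually written with index `i + 1`. -/
def IsExpansion (q : ℝ) (Ω : Set ℤ) (c : ℕ → ℤ) (x : ℝ) : Prop :=
  (∀ i, c i ∈ Ω) ∧ HasSum (fun i => (c i : ℝ) / q ^ (i + 1)) x

/-- The set `Γ_{q,m}` of all numbers having an expansion in base `q` over `{0, …, m}`. -/
def Gam (q : ℝ) (m : ℕ) : Set ℝ :=
  {x | ∃ c : ℕ → ℤ, IsExpansion q (Set.Icc 0 (m : ℤ)) c x}

/-- The set `𝓤_{m₁,m₂}(q)` of all numbers having exactly one expansion in base `q` over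
`{-m₂, …, m₁}`. -/
def UniqueExp (m₁ m₂ : ℕ) (q : ℝ) : Set ℝ :=
  {t | ∃! c : ℕ → ℤ, IsExpansion q (Set.Icc (-(m₂ : ℤ)) (m₁ : ℤ)) c t}

/-- The intersection `Γ_{q,m₁} ∩ (Γ_{q,m₂} + t)`. -/
def inter (m₁ m₂ : ℕ) (q t : ℝ) : Set ℝ :=
  Gam q m₁ ∩ ((fun x => x + t) '' Gam q m₂)

/-- `f` is a contracting similarity of the real line. -/
def IsContractingSimilarity (f : ℝ → ℝ) : Prop :=
  ∃ r : ℝ, 0 < r ∧ r < 1 ∧ ∀ x y, dist (f x) (f y) = r * dist x y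

/-- A self-similar set: a nonempty compact set `E` that is the union of its images under
finitely many contracting similarities. -/
def IsSelfSimilar (E : Set ℝ) : Prop :=
  E.Nonempty ∧ IsCompact E ∧
    ∃ (n : ℕ) (f : Fin n → ℝ → ℝ),
      (∀ i, IsContractingSimilarity (f i)) ∧ E = ⋃ i, f i '' E

/-- The set `𝓢_{m,m}(q)`. -/
def SelfSimilarTranslations (m : ℕ) (q : ℝ) : Set ℝ :=
  {t | t ∈ UniqueExp m m q ∧ IsSelfSimilar (inter m m q t)}

/-- The set `𝓗_{m,m}(q)` of the Hausdorff dimensions of `Γ_{q,m} ∩ (Γ_{q,m} + t)` for `t` in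
`𝓢_{m,m}(q)`. Hausdorff dimensions of subsets of `ℝ` are at most `1`, hence finite, so that
`ENNReal.toReal` loses nothing. -/
noncomputable def dimSet (m : ℕ) (q : ℝ) : Set ℝ :=
  {d | ∃ t ∈ SelfSimilarTranslations m q, d = (dimH (inter m m q t)).toReal}

/-- The critical base `q_c`. -/
noncomputable def qc (m : ℕ) : ℝ :=
  ((m : ℝ) + 2 + Real.sqrt ((m : ℝ) * ((m : ℝ) + 4))) / 2

end CantorIntersection

namespace CantorIntersection

open Filter Topology MeasureTheory Set
open scoped ENNReal NNReal

/-! If `t` has a unique expansion `(t_i)`, then `Γ ∩ (Γ + t)` consists of the values of all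
sequences whose `i`-th digit ranges over `{0,…,m} ∩ ({0,…,m} + t_i)`, a set of `m + 1 - |t_i|`
digits (`inter_val_eq_digitImage`). For `q > m + 1` distinct sequences have well separated values,
so the dimension is the average logarithm of these cardinalities divided by `log q`, exactly so for
periodic `t`.

Put `θ = 1 - m/(q-1)`. Uniqueness is governed by comparing tails of the expansion with `±θ`, and `q
< q_c` means `qθ < 1`.

(i) Repeating `k` pairs `1, -1` followed by `l` pairs `0, 0` gives tails of modulus below `1/q ≤ θ`,
hence a unique expansion. Periodicity makes the intersection self-similar, of dimension `(k c₁ + l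
c₂)/(k + l)`; these values are dense.

(ii) If `qθ < 1`, a tail once inside `(-θ, θ)` stays there, and after a nonzero digit it has modulus
at least `1 - qθ > 0`, so the next nonzero digit comes within a uniform number of steps
(`exists_gap_bound`). Thus `t` either ends in zeros, with dimension at least `c₂`, or has nonzero
digits of frequency bounded below, with dimension at most `c₂ - δ`. -/

/-! ### Hausdorff dimension bounds from separation and from covers -/

/-- A set parametrized by sequences over a finite alphabet, with the images of sequences first
differing at index `n` at distance at least `c / Q ^ n`, has dimension at least
`log (card W) / log Q`. -/
theorem le_dimH_range_of_separated {W : Type*} [Fintype W] {S : (ℕ → W) → ℝ} {c Q : ℝ}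
    (hc : 0 < c) (hQ : 1 < Q)
    (hS : ∀ a b n, (∀ i < n, a i = b i) → a n ≠ b n → c / Q ^ n ≤ |S a - S b|) :
    ENNReal.ofReal (Real.log (Fintype.card W) / Real.log Q) ≤ dimH (range S) := by
  obtain ⟨N, hN'⟩ : ∃ N, N = Fintype.card W := ⟨_, rfl⟩
  rw [← hN']
  rcases le_or_gt N 1 with hN | hN
  · interval_cases N <;> simp
  have hQ0 : 0 < Q := by linarith
  have hlogQ : 0 < Real.log Q := Real.log_pos hQ
  have hN1 : (1 : ℝ) < N := by exact_mod_cast hN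
  obtain ⟨r, hr⟩ : ∃ r, r = Real.log N / Real.log Q := ⟨_, rfl⟩
  have hr0 : 0 < r := hr ▸ div_pos (Real.log_pos hN1) hlogQ
  have hQr : Q ^ r = N := by
    rw [Real.rpow_def_of_pos hQ0, hr, mul_div_cancel₀ _ hlogQ.ne', Real.exp_log (by linarith)]
  let e : W ≃ Fin N := Fintype.equivFinOfCardEq hN'.symm
  have hfirst : ∀ a b : ℕ → W, a ≠ b → ∃ n, (∀ i < n, a i = b i) ∧ a n ≠ b n := by
    classical
    intro a b hab
    have h := Function.ne_iff.1 hab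
    exact ⟨Nat.find h, fun i hi => not_not.1 (Nat.find_min h hi), Nat.find_spec h⟩
  have hinj : Function.Injective S := by
    intro a b hab
    by_contra hne
    obtain ⟨n, h1, h2⟩ := hfirst a b hne
    have := hS a b n h1 h2
    rw [hab, sub_self, abs_zero] at this
    have : 0 < c / Q ^ n := by positivity
    linarith
  have : Nonempty W := ⟨e.symm ⟨0, by omega⟩⟩
  -- Rereading the letters as base-`N` digits maps the set onto `[0, 1]`. Since `Q ^ r = N`, this
  -- map is `r`-Hölder, which forces dimension at least `r`.
  let g : ℝ → ℝ := fun x => Real.ofDigits (fun i => e (Function.invFun S x i))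
  have hgS : ∀ a, g (S a) = Real.ofDigits (fun i => e (a i)) := by
    intro a
    simp only [g, Function.leftInverse_invFun hinj a]
  have hhol : HolderOnWith (Real.toNNReal ((c⁻¹) ^ r)) r.toNNReal g (range S) := by
    rintro _ ⟨a, rfl⟩ _ ⟨b, rfl⟩
    by_cases hab : a = b
    · simp [hab]
    obtain ⟨n, h1, h2⟩ := hfirst a b hab
    have h3 := hS a b n h1 h2
    have h4 : |g (S a) - g (S b)| ≤ ((N : ℝ) ^ n)⁻¹ := by
      rw [hgS, hgS]
      exact Real.abs_ofDigits_sub_ofDigits_le fun i hi => by rw [h1 i hi]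
    have h5 : ((N : ℝ) ^ n)⁻¹ ≤ (c⁻¹) ^ r * |S a - S b| ^ r := by
      rw [← Real.mul_rpow (by positivity) (abs_nonneg _)]
      have h6 : (Q ^ n)⁻¹ ≤ c⁻¹ * |S a - S b| := by
        rw [← div_eq_inv_mul, le_div_iff₀ hc, mul_comm, ← div_eq_mul_inv]
        exact h3
      have h7 : ((N : ℝ) ^ n)⁻¹ = ((Q ^ n)⁻¹) ^ r := by
        rw [Real.inv_rpow (by positivity), ← Real.rpow_natCast, ← Real.rpow_natCast,
          ← Real.rpow_mul hQ0.le, mul_comm, Real.rpow_mul hQ0.le, hQr]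
      rw [h7]
      exact Real.rpow_le_rpow (by positivity) h6 hr0.le
    rw [edist_dist, edist_dist, Real.coe_toNNReal _ hr0.le, Real.dist_eq, Real.dist_eq,
      ENNReal.ofReal_rpow_of_nonneg (abs_nonneg _) hr0.le]
    change _ ≤ ENNReal.ofReal _ * _
    rw [← ENNReal.ofReal_mul (by positivity)]
    exact ENNReal.ofReal_le_ofReal (h4.trans h5)
  have hsub : Icc (0 : ℝ) 1 ⊆ g '' range S := by
    intro y hy
    obtain ⟨d, -, hd⟩ := Real.ofDigits_SurjOn hN hy
    refine ⟨S (fun i => e.symm (d i)), ⟨_, rfl⟩, ?_⟩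
    rw [hgS]
    simpa using hd
  have h1 : 1 ≤ dimH (range S) / r.toNNReal := by
    calc (1 : ℝ≥0∞) = dimH (segment ℝ (0 : ℝ) 1) := (Real.dimH_segment zero_ne_one).symm
      _ = dimH (Icc (0 : ℝ) 1) := by rw [segment_eq_Icc zero_le_one]
      _ ≤ dimH (g '' range S) := dimH_mono hsub
      _ ≤ _ := hhol.dimH_image_le (by simpa using hr0)
  rw [ENNReal.le_div_iff_mul_le (Or.inl (by simpa using hr0)) (Or.inl ENNReal.coe_ne_top),
    one_mul] at h1
  rw [← hr]
  exact h1

/-- A set covered for each `k` by at most `C * M ^ k` balls of radius `R / Q ^ k` has dimension at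
most `log M / log Q`. -/
theorem dimH_le_of_card_cover {E : Set ℝ} {Q R C : ℝ} {M : ℕ} (hQ : 1 < Q) (hM : 1 ≤ M)
    (hR : 0 ≤ R)
    (hE : ∀ k : ℕ, ∃ F : Finset ℝ, (F.card : ℝ) ≤ C * M ^ k ∧
      E ⊆ ⋃ a ∈ F, Metric.closedBall a (R / Q ^ k)) :
    dimH E ≤ ENNReal.ofReal (Real.log M / Real.log Q) := by
  have hQ0 : 0 < Q := by linarith
  have hlogQ : 0 < Real.log Q := Real.log_pos hQ
  have hM1 : (1 : ℝ) ≤ M := by exact_mod_cast hM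
  obtain ⟨s, hs⟩ : ∃ s, s = Real.log M / Real.log Q := ⟨_, rfl⟩
  have hs0 : 0 ≤ s := hs ▸ div_nonneg (Real.log_nonneg hM1) hlogQ.le
  have hQs : Q ^ s = M := by
    rw [Real.rpow_def_of_pos hQ0, hs, mul_div_cancel₀ _ hlogQ.ne', Real.exp_log (by linarith)]
  rw [← hs]
  choose F hF1 hF2 using hE
  have hdiam : ∀ (k : ℕ) (i : F k),
      Metric.ediam (Metric.closedBall (i : ℝ) (R / Q ^ k)) ≤ ENNReal.ofReal (2 * R / Q ^ k) := by
    intro k i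
    rw [Real.closedBall_eq_Icc, Real.ediam_Icc]
    exact ENNReal.ofReal_le_ofReal (le_of_eq (by ring))
  have htend : Tendsto (fun k : ℕ => ENNReal.ofReal (2 * R / Q ^ k)) atTop (𝓝 0) := by
    rw [← ENNReal.ofReal_zero]
    refine ENNReal.tendsto_ofReal ?_
    exact tendsto_const_nhds.div_atTop (tendsto_pow_atTop_atTop_of_one_lt hQ)
  -- As `Q ^ s = M`, the growth of the number of balls cancels the decay of their diameters to the
  -- power `s`; the bound is independent of `k`.
  have hmeas : μH[s] E ≤ ENNReal.ofReal (C * (2 * R) ^ s) := by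
    refine (Measure.hausdorffMeasure_le_liminf_sum (ι := fun k => F k) s E (l := atTop)
      (fun k : ℕ => ENNReal.ofReal (2 * R / Q ^ k)) htend
      (fun k i => Metric.closedBall (i : ℝ) (R / Q ^ k))
      (Eventually.of_forall hdiam) (Eventually.of_forall fun k x hx => ?_)).trans ?_
    · simpa using hF2 k hx
    · refine liminf_le_of_frequently_le' (Frequently.of_forall fun k => ?_)
      calc ∑ i : F k, Metric.ediam (Metric.closedBall (i : ℝ) (R / Q ^ k)) ^ s
          ≤ ∑ i : F k, ENNReal.ofReal (2 * R / Q ^ k) ^ s :=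
            Finset.sum_le_sum fun i _ => ENNReal.rpow_le_rpow (hdiam k i) hs0
        _ = ENNReal.ofReal ((F k).card * (2 * R / Q ^ k) ^ s) := by
            rw [ENNReal.ofReal_rpow_of_nonneg (by positivity) hs0,
              ENNReal.ofReal_mul (by positivity)]
            simp
        _ ≤ _ := by
            refine ENNReal.ofReal_le_ofReal ?_
            have h7 : (Q ^ k) ^ s = (M : ℝ) ^ k := by
              rw [← Real.rpow_natCast, ← Real.rpow_natCast,
                ← Real.rpow_mul hQ0.le, mul_comm, Real.rpow_mul hQ0.le, hQs]
            rw [Real.div_rpow (by positivity) (by positivity), h7, ← mul_div_assoc,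
              div_le_iff₀ (by positivity)]
            calc _ ≤ C * M ^ k * (2 * R) ^ s := by gcongr; exact hF1 k
              _ = _ := by ring
  have h8 : μH[(s.toNNReal : ℝ)] E ≠ ∞ := by
    rw [Real.coe_toNNReal _ hs0]
    exact (hmeas.trans_lt ENNReal.ofReal_lt_top).ne
  exact dimH_le_of_hausdorffMeasure_ne_top h8

/-! ### Values of digit sequences -/

/-- The value of the digit sequence `c` in base `q`. -/
noncomputable def val (q : ℝ) (c : ℕ → ℤ) : ℝ := ∑' i, (c i : ℝ) / q ^ (i + 1)

section val

variable {q : ℝ} {m : ℕ} {c d : ℕ → ℤ}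

theorem hasSum_const_digit (hq : 1 < q) (a : ℝ) :
    HasSum (fun i : ℕ => a / q ^ (i + 1)) (a / (q - 1)) := by
  have h := (hasSum_geometric_of_lt_one (r := q⁻¹) (by positivity)
    (inv_lt_one_of_one_lt₀ hq)).mul_left (a / q)
  have hq1 : q - 1 ≠ 0 := by linarith
  have e1 : (fun i : ℕ => a / q ^ (i + 1)) = fun i => a / q * q⁻¹ ^ i := by
    funext i
    rw [inv_pow, pow_succ]
    field_simp
  have e2 : a / (q - 1) = a / q * (1 - q⁻¹)⁻¹ := by
    have : 1 - q⁻¹ = (q - 1) / q := by field_simp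
    rw [this]
    field_simp
  rw [e1, e2]
  exact h

theorem abs_digit_div_le (hq : 1 < q) (hc : ∀ i, |c i| ≤ (m : ℤ)) (i : ℕ) :
    |(c i : ℝ) / q ^ (i + 1)| ≤ (m : ℝ) / q ^ (i + 1) := by
  have h0 : (0 : ℝ) < q ^ (i + 1) := by positivity
  rw [abs_div, abs_of_pos h0]
  gcongr
  exact_mod_cast hc i

theorem summable_digits (hq : 1 < q) (hc : ∀ i, |c i| ≤ (m : ℤ)) :
    Summable fun i => (c i : ℝ) / q ^ (i + 1) :=
  Summable.of_norm_bounded (hasSum_const_digit hq m).summable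
    fun i => abs_digit_div_le hq hc i

theorem hasSum_iff_val_eq (hq : 1 < q) (hc : ∀ i, |c i| ≤ (m : ℤ)) {x : ℝ} :
    HasSum (fun i => (c i : ℝ) / q ^ (i + 1)) x ↔ val q c = x :=
  (summable_digits hq hc).hasSum_iff

theorem abs_val_le (hq : 1 < q) (hc : ∀ i, |c i| ≤ (m : ℤ)) : |val q c| ≤ m / (q - 1) := by
  rw [← Real.norm_eq_abs, val]
  exact tsum_of_norm_bounded (hasSum_const_digit hq m)
    fun i => abs_digit_div_le hq hc i

theorem val_eq_sum_add (hq : 1 < q) (hc : ∀ i, |c i| ≤ (m : ℤ)) (n : ℕ) :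
    val q c = ∑ i ∈ Finset.range n, (c i : ℝ) / q ^ (i + 1)
      + val q (fun i => c (i + n)) / q ^ n := by
  rw [val, ← (summable_digits hq hc).sum_add_tsum_nat_add n, val, ← tsum_div_const]
  congr 1
  refine tsum_congr fun i => ?_
  rw [div_div, ← pow_add]
  congr 2
  ring

theorem val_eq_head_add (hq : 1 < q) (hc : ∀ i, |c i| ≤ (m : ℤ)) :
    val q c = (c 0 + val q (fun i => c (i + 1))) / q := by
  rw [val_eq_sum_add hq hc 1]
  simp
  ring

theorem val_sub (hq : 1 < q) (hc : ∀ i, |c i| ≤ (m : ℤ)) (hd : ∀ i, |d i| ≤ (m : ℤ)) :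
    val q (fun i => c i - d i) = val q c - val q d := by
  rw [val, val, val, ← (summable_digits hq hc).tsum_sub (summable_digits hq hd)]
  refine tsum_congr fun i => ?_
  push_cast
  ring

theorem val_neg : val q (fun i => - c i) = - val q c := by
  rw [val, val, ← tsum_neg]
  refine tsum_congr fun i => ?_
  push_cast
  ring

theorem val_eq_of_forall_lt_eq_zero (hq : 1 < q) (hc : ∀ i, |c i| ≤ (m : ℤ)) {n : ℕ}
    (h0 : ∀ i < n, c i = 0) :
    val q c = (c n + val q (fun i => c (i + (n + 1)))) / q ^ (n + 1) := by
  rw [val_eq_sum_add hq hc (n + 1), Finset.sum_range_succ,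
    Finset.sum_eq_zero fun i hi => by simp [h0 i (Finset.mem_range.1 hi)]]
  ring

/-- The leading nonzero digit contributes at least `1` before scaling and the tail cancels at most
`m/(q-1)`. The bound is positive when `q > m + 1`. -/
theorem le_abs_val_of_ne_zero (hq : 1 < q) (hc : ∀ i, |c i| ≤ (m : ℤ)) {n : ℕ}
    (h0 : ∀ i < n, c i = 0) (hn : c n ≠ 0) :
    (1 - m / (q - 1)) / q ^ (n + 1) ≤ |val q c| := by
  have hp : (0 : ℝ) < q ^ (n + 1) := by positivity
  rw [val_eq_of_forall_lt_eq_zero hq hc h0, abs_div, abs_of_pos hp]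
  gcongr
  have h1 : (1 : ℝ) ≤ |(c n : ℝ)| := by exact_mod_cast Int.one_le_abs hn
  have h2 := abs_val_le hq (c := fun i => c (i + (n + 1))) fun i => hc _
  have h3 := abs_sub_abs_le_abs_sub (c n : ℝ) (-val q (fun i => c (i + (n + 1))))
  rw [abs_neg, sub_neg_eq_add] at h3
  linarith

/-- For `q ≤ 2m + 1` the numbers with an expansion over `{-m, …, m}` fill an interval. -/
theorem exists_val_eq (hm : 1 ≤ m) (hq : 1 < q) (hq2 : q ≤ 2 * m + 1) {y : ℝ}
    (hy : |y| ≤ m / (q - 1)) :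
    ∃ d : ℕ → ℤ, (∀ i, |d i| ≤ (m : ℤ)) ∧ val q d = y := by
  have hq1 : 0 < q - 1 := by linarith
  have hm1 : (1 : ℝ) ≤ m := by exact_mod_cast hm
  obtain ⟨R, hR⟩ : ∃ R : ℝ, R = m / (q - 1) := ⟨_, rfl⟩
  have hqR : q * R = m + R := by
    rw [hR]
    field_simp
    ring
  have hR2 : 1 / 2 ≤ R := by
    rw [hR, le_div_iff₀ hq1]
    linarith
  rw [← hR] at hy
  -- Greedy digit: the integer nearest to `q * z`, clamped to `[-m, m]`. Unclamped, the error is at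
  -- most `1/2 ≤ R`, which is where `q ≤ 2m + 1` enters; clamped, `|q * z| ≤ m + R` bounds it.
  have step : ∀ z : ℝ, |z| ≤ R → ∃ a : ℤ, |a| ≤ (m : ℤ) ∧ |q * z - a| ≤ R := by
    intro z hz
    have h1 : |q * z| ≤ m + R := by
      rw [abs_mul, abs_of_pos (by linarith : 0 < q), ← hqR]
      gcongr
    rw [abs_le] at h1
    have h2 := abs_le.1 (abs_sub_round (q * z))
    rcases lt_or_ge (m : ℤ) (round (q * z)) with h | h
    · have h3 : (m : ℝ) + 1 ≤ round (q * z) := by exact_mod_cast h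
      refine ⟨m, by simp, abs_le.2 ⟨?_, ?_⟩⟩ <;> push_cast <;> linarith
    rcases lt_or_ge (round (q * z)) (-(m : ℤ)) with h' | h'
    · have h3 : (round (q * z) : ℝ) + 1 ≤ -m := by exact_mod_cast h'
      refine ⟨-m, by simp, abs_le.2 ⟨?_, ?_⟩⟩ <;> push_cast <;> linarith
    · exact ⟨_, abs_le.2 ⟨h', h⟩, abs_le.2 ⟨by linarith, by linarith⟩⟩
  choose! f hf1 hf2 using step
  let z : ℕ → ℝ := fun n => Nat.rec y (fun _ w => q * w - f w) n
  have hz : ∀ n, |z n| ≤ R := by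
    intro n
    induction n with
    | zero => exact hy
    | succ n ih => exact hf2 _ ih
  have hd : ∀ i, |f (z i)| ≤ (m : ℤ) := fun i => hf1 _ (hz i)
  refine ⟨fun i => f (z i), hd, ?_⟩
  have hpart : ∀ n, ∑ i ∈ Finset.range n, (f (z i) : ℝ) / q ^ (i + 1) = y - z n / q ^ n := by
    intro n
    induction n with
    | zero => simp [z]
    | succ n ih =>
      have hzs : z (n + 1) = q * z n - f (z n) := rfl
      rw [Finset.sum_range_succ, ih, hzs]
      field_simp
      ring
  have h1 := (summable_digits hq hd).hasSum.tendsto_sum_nat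
  refine tendsto_nhds_unique h1 ?_
  simp_rw [hpart]
  have h2 : Tendsto (fun n => z n / q ^ n) atTop (𝓝 0) := by
    refine squeeze_zero_norm (a := fun n => R / q ^ n) (fun n => ?_)
      (tendsto_const_nhds.div_atTop (tendsto_pow_atTop_atTop_of_one_lt hq))
    have : (0 : ℝ) < q ^ n := by positivity
    rw [norm_div, Real.norm_eq_abs, Real.norm_eq_abs, abs_of_pos this]
    gcongr
    exact hz n
  simpa using tendsto_const_nhds.sub h2

end val

/-! ### Unique expansions and tail conditions -/

/-- `c` is a digit sequence over `{-m, …, m}` and the only one with its value in base `q`. -/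
def IsUniqueDigits (q : ℝ) (m : ℕ) (c : ℕ → ℤ) : Prop :=
  (∀ i, |c i| ≤ (m : ℤ)) ∧ ∀ d : ℕ → ℤ, (∀ i, |d i| ≤ (m : ℤ)) → val q d = val q c → d = c

section unique

variable {q : ℝ} {m : ℕ} {c : ℕ → ℤ}

theorem mem_uniqueExp_iff (hq : 1 < q) {t : ℝ} :
    t ∈ UniqueExp m m q ↔ ∃ c, IsUniqueDigits q m c ∧ val q c = t := by
  have key : ∀ c, IsExpansion q (Set.Icc (-(m : ℤ)) (m : ℤ)) c t ↔
      (∀ i, |c i| ≤ (m : ℤ)) ∧ val q c = t := by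
    intro c
    have : (∀ i, c i ∈ Set.Icc (-(m : ℤ)) (m : ℤ)) ↔ ∀ i, |c i| ≤ (m : ℤ) := by
      simp only [Set.mem_Icc, abs_le]
    rw [IsExpansion, this]
    exact and_congr_right fun h => hasSum_iff_val_eq hq h
  simp only [UniqueExp, Set.mem_ofPred_eq, ExistsUnique, key]
  constructor
  · rintro ⟨c, ⟨h1, h2⟩, h3⟩
    exact ⟨c, ⟨h1, fun d hd hdc => h3 d ⟨hd, hdc.trans h2⟩⟩, h2⟩
  · rintro ⟨c, ⟨h1, h3⟩, h2⟩
    exact ⟨c, ⟨h1, h2⟩, fun d hd => h3 d hd.1 (hd.2.trans h2.symm)⟩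

theorem IsUniqueDigits.neg (h : IsUniqueDigits q m c) : IsUniqueDigits q m fun i => - c i := by
  refine ⟨fun i => by simpa using h.1 i, fun d hd hdc => ?_⟩
  have := h.2 (fun i => - d i) (fun i => by simpa using hd i) (by rw [val_neg, hdc, val_neg, neg_neg])
  funext i
  have := congrFun this i
  linarith

/-- Otherwise the digit can be raised by `1` and the tail lowered by `1`: the new tail still lies in
the interval filled by expansions, giving a second expansion. -/
theorem IsUniqueDigits.tail_lt (h : IsUniqueDigits q m c) (hm : 1 ≤ m) (hq : m + 1 < q)
    (hq2 : q ≤ 2 * m + 1) {n : ℕ} (hn : c n < m) :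
    val q (fun i => c (i + (n + 1))) < 1 - m / (q - 1) := by
  have hm1 : (1 : ℝ) ≤ m := by exact_mod_cast hm
  have hq1 : 1 < q := by linarith
  by_contra! hlt
  have h1 := abs_le.1 (abs_val_le hq1 (c := fun i => c (i + (n + 1))) fun i => h.1 _)
  have h2 : (m : ℝ) / (q - 1) < 1 := by rw [div_lt_one (by linarith)]; linarith
  obtain ⟨d, hd1, hd2⟩ := exists_val_eq hm hq1 hq2
    (y := val q (fun i => c (i + (n + 1))) - 1) (abs_le.2 ⟨by linarith, by linarith⟩)
  let e : ℕ → ℤ := fun i => if i < n then c i else if i = n then c n + 1 else d (i - (n + 1))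
  have he : ∀ i, |e i| ≤ (m : ℤ) := by
    intro i
    simp only [e]
    split_ifs
    · exact h.1 i
    · have := abs_le.1 (h.1 n)
      exact abs_le.2 ⟨by linarith, by linarith⟩
    · exact hd1 _
  have hec : val q e = val q c := by
    rw [val_eq_sum_add hq1 he (n + 1), val_eq_sum_add hq1 h.1 (n + 1), Finset.sum_range_succ,
      Finset.sum_range_succ]
    have e1 : (fun i => e (i + (n + 1))) = d := by
      funext i
      simp only [e]
      rw [if_neg (by omega), if_neg (by omega), Nat.add_sub_cancel]
    have e2 : e n = c n + 1 := by simp [e]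
    have e3 : ∑ i ∈ Finset.range n, (e i : ℝ) / q ^ (i + 1)
        = ∑ i ∈ Finset.range n, (c i : ℝ) / q ^ (i + 1) :=
      Finset.sum_congr rfl fun i hi => by simp [e, Finset.mem_range.1 hi]
    rw [e1, e2, e3, hd2]
    push_cast
    ring
  have := congrFun (h.2 e he hec) n
  simp [e] at this

theorem IsUniqueDigits.lt_tail (h : IsUniqueDigits q m c) (hm : 1 ≤ m) (hq : m + 1 < q)
    (hq2 : q ≤ 2 * m + 1) {n : ℕ} (hn : -(m : ℤ) < c n) :
    -(1 - m / (q - 1)) < val q (fun i => c (i + (n + 1))) := by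
  have := h.neg.tail_lt hm hq hq2 (n := n) (by linarith)
  rw [val_neg (c := fun i => c (i + (n + 1)))] at this
  linarith

/-- At the first disagreement the digits differ by at least `1`, while the difference of the two
tails is less than `m/(q-1) + θ = 1`, so the values cannot agree. -/
theorem isUniqueDigits_of_tails (hq : 1 < q) (hc : ∀ i, |c i| ≤ (m : ℤ))
    (ht : ∀ n, |val q (fun i => c (i + (n + 1)))| < 1 - m / (q - 1)) : IsUniqueDigits q m c := by
  classical
  refine ⟨hc, fun d hd hdc => ?_⟩
  by_contra hne
  have hex := Function.ne_iff.1 hne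
  obtain ⟨n, hn0, hn⟩ : ∃ n, (∀ i < n, d i - c i = 0) ∧ d n - c n ≠ 0 :=
    ⟨Nat.find hex, fun i hi => sub_eq_zero.2 (not_not.1 (Nat.find_min hex hi)),
      sub_ne_zero.2 (Nat.find_spec hex)⟩
  have hb : ∀ i, |d i - c i| ≤ ((2 * m : ℕ) : ℤ) := by
    intro i
    have h1 := abs_le.1 (hc i)
    have h2 := abs_le.1 (hd i)
    push_cast
    exact abs_le.2 ⟨by linarith, by linarith⟩
  have h1 := val_eq_of_forall_lt_eq_zero hq hb hn0
  rw [val_sub hq hd hc, hdc, sub_self,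
    val_sub hq (c := fun i => d (i + (n + 1))) (fun i => hd _) (fun i => hc _)] at h1
  have hp : q ^ (n + 1) ≠ 0 := by positivity
  have h2 := ((div_eq_zero_iff.1 h1.symm).resolve_right hp)
  have h3 : (1 : ℝ) ≤ |((d n - c n : ℤ) : ℝ)| := by exact_mod_cast Int.one_le_abs hn
  have h4 := abs_le.1 (abs_val_le hq (c := fun i => d (i + (n + 1))) fun i => hd _)
  have h5 := abs_lt.1 (ht n)
  rcases le_abs'.1 h3 with h | h <;> linarith

end unique

/-! ### The intersection as a set of restricted digit sequences -/

/-- The digits `a ∈ {0, …, m}` with `a - d ∈ {0, …, m}`. -/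
noncomputable def digitSet (m : ℕ) (d : ℤ) : Finset ℤ := Finset.Icc (max 0 d) (min m (m + d))

/-- The numbers having an expansion whose digits `c i` and `c i - t i` all lie in `{0, …, m}`. -/
def digitImage (q : ℝ) (m : ℕ) (t : ℕ → ℤ) : Set ℝ :=
  val q '' {c | ∀ i, c i ∈ digitSet m (t i)}

section digitImage

variable {q : ℝ} {m : ℕ} {t : ℕ → ℤ}

theorem mem_digitSet {d a : ℤ} :
    a ∈ digitSet m d ↔ (0 ≤ a ∧ a ≤ m) ∧ (0 ≤ a - d ∧ a - d ≤ m) := by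
  simp only [digitSet, Finset.mem_Icc]
  omega

theorem abs_le_of_mem_digitSet {d a : ℤ} (h : a ∈ digitSet m d) : |a| ≤ (m : ℤ) := by
  rw [mem_digitSet] at h
  exact abs_le.2 ⟨by omega, by omega⟩

theorem abs_sub_le_of_mem_digitSet {d a b : ℤ} (ha : a ∈ digitSet m d) (hb : b ∈ digitSet m d) :
    |a - b| ≤ (m : ℤ) := by
  rw [mem_digitSet] at ha hb
  exact abs_le.2 ⟨by omega, by omega⟩

theorem card_digitSet {d : ℤ} (h : |d| ≤ (m : ℤ)) : (digitSet m d).card = m + 1 - d.natAbs := by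
  rw [digitSet, Int.card_Icc]
  rw [abs_le] at h
  omega

theorem digitSet_nonempty {d : ℤ} (h : |d| ≤ (m : ℤ)) : max 0 d ∈ digitSet m d := by
  rw [mem_digitSet]
  rw [abs_le] at h
  omega

/-- If `x = Σ a_i/q^i = Σ b_i/q^i + t`, then `a - b` is an expansion of `t` over `{-m,…,m}`, so
uniqueness gives `a - b = t` digit by digit. -/
theorem inter_val_eq_digitImage (hq : 1 < q) (ht : IsUniqueDigits q m t) :
    inter m m q (val q t) = digitImage q m t := by
  have key : ∀ (c : ℕ → ℤ) (x : ℝ), IsExpansion q (Set.Icc 0 (m : ℤ)) c x ↔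
      (∀ i, 0 ≤ c i ∧ c i ≤ (m : ℤ)) ∧ val q c = x := by
    intro c x
    refine and_congr_right fun h => hasSum_iff_val_eq (m := m) hq fun i => ?_
    have := h i
    exact abs_le.2 ⟨by linarith [this.1], this.2⟩
  have habs : ∀ {c : ℕ → ℤ}, (∀ i, 0 ≤ c i ∧ c i ≤ (m : ℤ)) → ∀ i, |c i| ≤ (m : ℤ) :=
    fun h i => abs_le.2 ⟨by linarith [(h i).1], (h i).2⟩
  ext x
  simp only [inter, Gam, digitImage, key, mem_inter_iff, mem_image, mem_ofPred_eq, mem_digitSet]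
  constructor
  · rintro ⟨⟨a, ha, rfl⟩, _, ⟨b, hb, rfl⟩, hx⟩
    refine ⟨a, fun i => ⟨ha i, ?_⟩, rfl⟩
    have := ht.2 (fun i => a i - b i)
      (fun i => abs_le.2 ⟨by linarith [(ha i).1, (hb i).2], by linarith [(hb i).1, (ha i).2]⟩)
      (by rw [val_sub hq (habs ha) (habs hb)]; linarith)
    have h1 := congrFun this i
    have h2 := hb i
    constructor <;> linarith [h2.1, h2.2]
  · rintro ⟨c, hc, rfl⟩
    refine ⟨⟨c, fun i => (hc i).1, rfl⟩, val q c - val q t, ⟨fun i => c i - t i,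
      fun i => (hc i).2, ?_⟩, by ring⟩
    exact val_sub hq (habs fun i => (hc i).1) ht.1

/-- Prefixes of length `n₀ + L * k` serve as centres of the covering balls; `n₀` and `C` absorb an
uncontrolled initial segment. -/
theorem dimH_digitImage_le (hq : 1 < q) {n₀ L M : ℕ} {C : ℝ} (hL : 0 < L) (hM : 1 ≤ M)
    (hcard : ∀ k : ℕ, ((∏ i ∈ Finset.range (n₀ + L * k), (digitSet m (t i)).card : ℕ) : ℝ)
      ≤ C * M ^ k) :
    dimH (digitImage q m t) ≤ ENNReal.ofReal (Real.log M / (L * Real.log q)) := by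
  have hQ : 1 < q ^ L := one_lt_pow₀ hq hL.ne'
  have hq1 : 0 < q - 1 := by linarith
  rw [← Real.log_pow]
  refine dimH_le_of_card_cover (R := m / (q - 1) / q ^ n₀) (C := C) hQ hM (by positivity)
    fun k => ?_
  obtain ⟨n, hn⟩ : ∃ n, n = n₀ + L * k := ⟨_, rfl⟩
  have hqn : q ^ n = q ^ n₀ * (q ^ L) ^ k := by rw [hn, pow_add, pow_mul]
  classical
  refine ⟨(Fintype.piFinset fun i : Fin n => digitSet m (t i)).image
    fun w => ∑ i : Fin n, (w i : ℝ) / q ^ ((i : ℕ) + 1), ?_, ?_⟩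
  · refine le_trans ?_ (hcard k)
    rw [← hn, ← Fin.prod_univ_eq_prod_range (fun i => (digitSet m (t i)).card),
      ← Fintype.card_piFinset]
    exact_mod_cast Finset.card_image_le
  · rintro _ ⟨c, hc, rfl⟩
    have hb : ∀ i, |c i| ≤ (m : ℤ) := fun i => abs_le_of_mem_digitSet (hc i)
    refine mem_biUnion (x := ∑ i : Fin n, (c i : ℝ) / q ^ ((i : ℕ) + 1)) ?_ ?_
    · refine Finset.mem_coe.2 (Finset.mem_image.2 ⟨fun i => c i, ?_, rfl⟩)
      exact Fintype.mem_piFinset.2 fun i => hc i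
    · rw [Metric.mem_closedBall, Real.dist_eq, val_eq_sum_add hq hb n,
        Fin.sum_univ_eq_sum_range (fun i => (c i : ℝ) / q ^ (i + 1)), add_sub_cancel_left, abs_div,
        abs_of_pos (by positivity : 0 < q ^ n), div_div, ← hqn]
      gcongr
      exact abs_val_le hq fun i => hb _

/-- Each period block is one letter of a product alphabet, with base `q ^ p`. Differences of
admissible digits have modulus at most `m`, not `2m`, so `q > m + 1` suffices for separation. -/
theorem le_dimH_digitImage (hq : m + 1 < q) {p : ℕ} (hp : 0 < p) (ht : ∀ i, t (i + p) = t i) :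
    ENNReal.ofReal (Real.log (∏ i ∈ Finset.range p, (digitSet m (t i)).card : ℕ)
      / (p * Real.log q)) ≤ dimH (digitImage q m t) := by
  have hm0 : (0 : ℝ) ≤ m := by positivity
  have hq1 : 1 < q := by linarith
  have hq0 : 0 < q := by linarith
  have hθ : 0 < 1 - m / (q - 1) := by rw [sub_pos, div_lt_one] <;> linarith
  let S : (ℕ → ∀ i : Fin p, digitSet m (t i)) → ℝ :=
    fun a => val q fun i => (a (i / p) ⟨i % p, Nat.mod_lt _ hp⟩ : ℤ)
  have hmod : ∀ i, t (i % p) = t i := Function.Periodic.map_mod_nat ht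
  have hmem : ∀ (a : ℕ → ∀ i : Fin p, digitSet m (t i)) (i : ℕ),
      (a (i / p) ⟨i % p, Nat.mod_lt _ hp⟩ : ℤ) ∈ digitSet m (t i) := by
    intro a i
    rw [← hmod i]
    exact (a (i / p) ⟨i % p, Nat.mod_lt _ hp⟩).2
  have hsep : ∀ a b n, (∀ i < n, a i = b i) → a n ≠ b n →
      (1 - m / (q - 1)) / q ^ p / (q ^ p) ^ n ≤ |S a - S b| := by
    classical
    intro a b n h1 h2
    obtain ⟨j, hj⟩ := Function.ne_iff.1 h2
    let e : ℕ → ℤ := fun i => (a (i / p) ⟨i % p, Nat.mod_lt _ hp⟩ : ℤ)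
      - (b (i / p) ⟨i % p, Nat.mod_lt _ hp⟩ : ℤ)
    have hjn : e (p * n + j) ≠ 0 := by
      have hd : (p * n + (j : ℕ)) / p = n := by
        rw [Nat.mul_add_div hp, Nat.div_eq_of_lt j.2, add_zero]
      have hm' : (p * n + (j : ℕ)) % p = j := by
        rw [Nat.mul_add_mod, Nat.mod_eq_of_lt j.2]
      have hne : ∀ j' : Fin p, j' = j → (a n j' : ℤ) - b n j' ≠ 0 := by
        rintro _ rfl
        exact sub_ne_zero.2 fun h => hj (Subtype.ext h)
      simp only [e, hd]
      exact hne _ (Fin.ext hm')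
    have hex : ∃ i, e i ≠ 0 := ⟨_, hjn⟩
    -- The first differing digit lies inside block `n` or earlier; this accounts for the extra `q ^
    -- p` in the separation constant.
    have hfind : Nat.find hex + 1 ≤ p + p * n := by
      have := Nat.find_min' hex hjn
      have := j.2
      omega
    have hle := le_abs_val_of_ne_zero hq1 (c := e)
      (fun i => abs_sub_le_of_mem_digitSet (hmem a i) (hmem b i))
      (fun i hi => not_not.1 (Nat.find_min hex hi)) (Nat.find_spec hex)
    have hS : val q e = S a - S b :=
      val_sub hq1 (fun i => abs_le_of_mem_digitSet (hmem a i))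
        (fun i => abs_le_of_mem_digitSet (hmem b i))
    rw [hS] at hle
    refine le_trans ?_ hle
    rw [div_div, ← pow_mul, ← pow_add]
    gcongr
    exact hq1.le
  have h := le_dimH_range_of_separated (div_pos hθ (pow_pos hq0 p)) (one_lt_pow₀ hq1 hp.ne') hsep
  rw [Real.log_pow, Fintype.card_pi] at h
  simp only [Fintype.card_coe] at h
  rw [Fin.prod_univ_eq_prod_range (fun i => (digitSet m (t i)).card)] at h
  refine h.trans (dimH_mono ?_)
  rintro _ ⟨a, rfl⟩
  exact ⟨_, hmem a, rfl⟩

/-- For a periodic `t` the dimension is the average logarithmic number of digits. -/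
theorem dimH_digitImage_of_periodic (hq : m + 1 < q) {p : ℕ} (hp : 0 < p)
    (ht : ∀ i, t (i + p) = t i) (htm : ∀ i, |t i| ≤ (m : ℤ)) :
    dimH (digitImage q m t) = ENNReal.ofReal
      (Real.log (∏ i ∈ Finset.range p, (digitSet m (t i)).card : ℕ) / (p * Real.log q)) := by
  have hm0 : (0 : ℝ) ≤ m := by positivity
  refine le_antisymm (dimH_digitImage_le (by linarith) (n₀ := 0) (C := 1) hp ?_ fun k => ?_)
    (le_dimH_digitImage hq hp ht)
  · exact Finset.prod_pos fun i _ => Finset.card_pos.2 ⟨_, digitSet_nonempty (htm i)⟩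
  · refine le_of_eq ?_
    rw [one_mul, ← Nat.cast_pow, zero_add]
    congr 1
    induction k with
    | zero => simp
    | succ k ih =>
      rw [Nat.mul_succ, Finset.prod_range_add, ih, pow_succ]
      congr 1
      refine Finset.prod_congr rfl fun i _ => ?_
      rw [add_comm, mul_comm, ← smul_eq_mul, Function.Periodic.nsmul ht k]

theorem val_append (hq : 1 < q) {c w : ℕ → ℤ} {n : ℕ}
    (hb : ∀ i, |if i < n then w i else c (i - n)| ≤ (m : ℤ)) :
    val q (fun i => if i < n then w i else c (i - n))
      = ∑ i ∈ Finset.range n, (w i : ℝ) / q ^ (i + 1) + val q c / q ^ n := by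
  rw [val_eq_sum_add hq hb n]
  congr 1
  · exact Finset.sum_congr rfl fun i hi => by simp [Finset.mem_range.1 hi]
  · simp

/-- Each admissible block of length `p` gives a similarity prepending it, with ratio `q⁻ᵖ`;
periodicity makes the shifted sequence admissible again. Compactness comes from the product of
finite digit sets. -/
theorem isSelfSimilar_digitImage (hq : 1 < q) {p : ℕ} (hp : 0 < p)
    (ht : ∀ i, t (i + p) = t i) (htm : ∀ i, |t i| ≤ (m : ℤ)) :
    IsSelfSimilar (digitImage q m t) := by
  have hq0 : 0 < q := by linarith
  refine ⟨⟨_, fun i => max 0 (t i), fun i => digitSet_nonempty (htm i), rfl⟩, ?_, ?_⟩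
  · have himg : digitImage q m t
        = range fun w : ∀ i, digitSet m (t i) => val q fun i => (w i : ℤ) := by
      ext x
      constructor
      · rintro ⟨c, hc, rfl⟩
        exact ⟨fun i => ⟨c i, hc i⟩, rfl⟩
      · rintro ⟨w, rfl⟩
        exact ⟨_, fun i => (w i).2, rfl⟩
    rw [himg]
    refine isCompact_range (continuous_tsum (u := fun i => (m : ℝ) / q ^ (i + 1)) (fun i => ?_)
      (hasSum_const_digit hq m).summable fun i w => ?_)
    · refine Continuous.div_const ?_ _
      exact continuous_of_discreteTopology.comp (continuous_subtype_val.comp (continuous_apply i))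
    · exact abs_digit_div_le hq (c := fun i => (w i : ℤ))
        (fun i => abs_le_of_mem_digitSet (w i).2) i
  · let W := ∀ i : Fin p, digitSet m (t i)
    let f : W → ℝ → ℝ := fun w x =>
      ∑ i : Fin p, ((w i : ℤ) : ℝ) / q ^ ((i : ℕ) + 1) + x / q ^ p
    refine ⟨Fintype.card W, fun j => f ((Fintype.equivFin W).symm j), fun j => ?_, ?_⟩
    · refine ⟨(q ^ p)⁻¹, by positivity, inv_lt_one_of_one_lt₀ (one_lt_pow₀ hq hp.ne'),
        fun x y => ?_⟩
      simp only [f]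
      rw [dist_add_left, Real.dist_eq, Real.dist_eq, ← sub_div, abs_div,
        abs_of_pos (pow_pos hq0 p), div_eq_inv_mul]
    · rw [(Fintype.equivFin W).symm.surjective.iUnion_comp fun w => f w '' digitImage q m t]
      ext x
      simp only [mem_iUnion]
      constructor
      · rintro ⟨c, hc, rfl⟩
        refine ⟨fun i => ⟨c i, hc i⟩, _, ⟨fun i => c (i + p), fun i => ?_, rfl⟩, ?_⟩
        · rw [← ht i]
          exact hc _
        · rw [val_eq_sum_add hq (fun i => abs_le_of_mem_digitSet (hc i)) p]
          simp only [f]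
          rw [Fin.sum_univ_eq_sum_range (fun i => (c i : ℝ) / q ^ (i + 1))]
      · rintro ⟨w, _, ⟨c, hc, rfl⟩, rfl⟩
        let w' : ℕ → ℤ := fun i => if h : i < p then w ⟨i, h⟩ else 0
        have hmem : ∀ i, (if i < p then w' i else c (i - p)) ∈ digitSet m (t i) := by
          intro i
          split_ifs with h
          · simp only [w', dif_pos h]
            exact (w ⟨i, h⟩).2
          · have h1 := ht (i - p)
            rw [Nat.sub_add_cancel (not_lt.1 h)] at h1
            rw [h1]
            exact hc _
        refine ⟨_, hmem, ?_⟩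
        rw [val_append hq (fun i => abs_le_of_mem_digitSet (hmem i))]
        simp only [f]
        rw [← Fin.sum_univ_eq_sum_range (fun i => (w' i : ℝ) / q ^ (i + 1))]
        simp [w']

/-- If `t` is eventually zero, the digits are eventually unrestricted. -/
theorem le_dimH_digitImage_of_eventually_zero (hq : m + 1 < q) (htm : ∀ i, |t i| ≤ (m : ℤ)) {n : ℕ}
    (ht : ∀ i, n ≤ i → t i = 0) :
    ENNReal.ofReal (Real.log (m + 1) / Real.log q) ≤ dimH (digitImage q m t) := by
  have hm0 : (0 : ℝ) ≤ m := by positivity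
  have hq0 : 0 < q := by linarith
  have hq1 : 1 < q := by linarith
  have h := le_dimH_digitImage (t := fun _ => 0) hq one_pos (fun _ => rfl)
  rw [Finset.prod_range_one, card_digitSet (by simp)] at h
  simp only [Int.natAbs_zero, Nat.sub_zero, Nat.cast_one, one_mul, Nat.cast_add] at h
  refine h.trans ?_
  -- Prepending one fixed admissible prefix embeds a scaled copy of the unrestricted set, whose
  -- dimension was bounded by the case `t = 0` of period `1`.
  let f : ℝ → ℝ := fun x => ∑ i ∈ Finset.range n, ((max 0 (t i) : ℤ) : ℝ) / q ^ (i + 1) + x / q ^ n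
  have hf : AntilipschitzWith (Real.toNNReal (q ^ n)) f := by
    refine AntilipschitzWith.of_le_mul_dist fun x y => ?_
    simp only [f]
    rw [dist_add_left, Real.dist_eq, Real.dist_eq, ← sub_div, abs_div,
      abs_of_pos (pow_pos hq0 n), Real.coe_toNNReal _ (by positivity)]
    rw [mul_div_cancel₀ _ (by positivity)]
  refine (hf.le_dimH_image _).trans (dimH_mono ?_)
  rintro _ ⟨_, ⟨c, hc, rfl⟩, rfl⟩
  have hmem : ∀ i, (if i < n then max 0 (t i) else c (i - n)) ∈ digitSet m (t i) := by
    intro i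
    split_ifs with h
    · exact digitSet_nonempty (htm i)
    · rw [ht i (not_lt.1 h)]
      exact hc _
  exact ⟨_, hmem, val_append hq1 (w := fun i => max 0 (t i))
    (fun i => abs_le_of_mem_digitSet (hmem i))⟩

end digitImage

/-! ### The critical base -/

section critical

variable {q : ℝ} {m : ℕ}

/-- `q_c` is the larger root of `q² - (m+2)q + 1`, and `qθ < 1` says that this polynomial is
negative. -/
theorem mul_lt_one_of_lt_qc (hq : m + 1 < q) (hqc : q < qc m) : q * (1 - m / (q - 1)) < 1 := by
  have hm0 : (0 : ℝ) ≤ m := by positivity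
  have hq1 : 0 < q - 1 := by linarith
  have h1 : 2 * q - (m + 2) < Real.sqrt ((m : ℝ) * (m + 4)) := by rw [qc] at hqc; linarith
  rw [Real.lt_sqrt (by linarith)] at h1
  have h2 : q * (1 - m / (q - 1)) = q * (q - 1 - m) / (q - 1) := by field_simp
  rw [h2, div_lt_one hq1]
  nlinarith

theorem le_two_mul_add_one (hm : 1 ≤ m) (hq : m + 1 < q) (hqc : q < qc m) : q ≤ 2 * m + 1 := by
  have hm1 : (1 : ℝ) ≤ m := by exact_mod_cast hm
  have hq1 : 0 < q - 1 := by linarith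
  have h1 := mul_lt_one_of_lt_qc hq hqc
  have h2 : q * (1 - m / (q - 1)) = q * (q - 1 - m) / (q - 1) := by field_simp
  rw [h2, div_lt_one hq1] at h1
  nlinarith

theorem add_one_lt_of_qc_le (hm : 1 ≤ m) (hq : qc m ≤ q) : m + 1 < q := by
  have hm1 : (1 : ℝ) ≤ m := by exact_mod_cast hm
  have h1 : (m : ℝ) < Real.sqrt ((m : ℝ) * (m + 4)) := by
    rw [Real.lt_sqrt (by linarith)]
    nlinarith
  rw [qc] at hq
  linarith

theorem one_le_mul_of_qc_le (hm : 1 ≤ m) (hq : qc m ≤ q) : 1 ≤ q * (1 - m / (q - 1)) := by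
  have hm0 : (0 : ℝ) ≤ m := by positivity
  have hmq := add_one_lt_of_qc_le hm hq
  have hq1 : 0 < q - 1 := by linarith
  have h1 : Real.sqrt ((m : ℝ) * (m + 4)) ≤ 2 * q - (m + 2) := by rw [qc] at hq; linarith
  rw [Real.sqrt_le_left (by linarith)] at h1
  have h2 : q * (1 - m / (q - 1)) = q * (q - 1 - m) / (q - 1) := by field_simp
  rw [h2, one_le_div hq1]
  nlinarith

end critical

/-! ### Below the critical base: the dimension gap -/

section gap

variable {q : ℝ} {m : ℕ} {t : ℕ → ℤ}

/-- Below `q_c`, small tails stay small, and a nonzero digit is followed by a tail bounded away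
from zero. -/
theorem IsUniqueDigits.tail_step (h : IsUniqueDigits q m t) (hm : 1 ≤ m) (hq : m + 1 < q)
    (hqc : q < qc m) {n : ℕ} (hn : |val q fun i => t (i + n)| < 1 - m / (q - 1)) :
    |val q fun i => t (i + (n + 1))| < 1 - m / (q - 1) ∧
      (t n ≠ 0 → 1 - q * (1 - m / (q - 1)) ≤ |val q fun i => t (i + (n + 1))|) := by
  have hm1 : (1 : ℝ) ≤ m := by exact_mod_cast hm
  have hm1' : (1 : ℤ) ≤ m := by exact_mod_cast hm
  have hq1 : 1 < q := by linarith
  have hq0 : 0 < q := by linarith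
  have hε := mul_lt_one_of_lt_qc hq hqc
  have hq2 : q ≤ 2 * m + 1 := le_two_mul_add_one hm hq hqc
  have hθ : 0 < 1 - m / (q - 1) := by rw [sub_pos, div_lt_one] <;> linarith
  have hhead : val q (fun i => t (i + n)) * q = t n + val q fun i => t (i + (n + 1)) := by
    rw [val_eq_head_add hq1 (c := fun i => t (i + n)) fun i => h.1 _, div_mul_cancel₀ _ hq0.ne']
    simp only [zero_add, add_right_comm _ 1 n, add_assoc]
  have hlow : -(m : ℤ) < t n → -(1 - m / (q - 1)) < val q fun i => t (i + (n + 1)) :=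
    fun hn => h.lt_tail hm hq hq2 hn
  have hup : t n < m → (val q fun i => t (i + (n + 1))) < 1 - m / (q - 1) :=
    fun hn => h.tail_lt hm hq hq2 hn
  obtain ⟨θ, hθ'⟩ : ∃ θ, θ = 1 - (m : ℝ) / (q - 1) := ⟨_, rfl⟩
  rw [← hθ'] at hlow hup hn hε hθ ⊢
  have hn' := abs_lt.1 hn
  have h1 : val q (fun i => t (i + n)) * q < q * θ := by nlinarith
  have h2 : -(q * θ) < val q (fun i => t (i + n)) * q := by nlinarith
  rw [hhead] at h1 h2
  -- With `|t n + next tail| < qθ < 1`, a nonzero digit forces the next tail to have the opposite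
  -- sign and modulus above `1 - qθ`; uniqueness bounds it by `θ` on that side.
  rcases lt_trichotomy (t n) 0 with h0 | h0 | h0
  · have h3 : (t n : ℝ) ≤ -1 := by exact_mod_cast Int.le_sub_one_of_lt h0
    have h4 := hup (by linarith)
    exact ⟨abs_lt.2 ⟨by linarith, h4⟩, fun _ => le_abs.2 (Or.inl (by linarith))⟩
  · exact ⟨abs_lt.2 ⟨hlow (by linarith), hup (by linarith)⟩, fun h => absurd h0 h⟩
  · have h3 : (1 : ℝ) ≤ t n := by exact_mod_cast h0
    have h4 := hlow (by linarith)
    exact ⟨abs_lt.2 ⟨h4, by linarith⟩, fun _ => le_abs.2 (Or.inr (by linarith))⟩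

/-- Below `q_c`, a unique expansion is eventually zero or has nonzero digits with bounded gaps;
the bound depends on `q` and `m` only. -/
theorem exists_gap_bound (hm : 1 ≤ m) (hq : m + 1 < q) (hqc : q < qc m) :
    ∃ L : ℕ, ∀ t, IsUniqueDigits q m t →
      (∃ n, ∀ i, n ≤ i → t i = 0) ∨ ∃ n₀, ∀ n, n₀ ≤ n → ∃ j ≤ L, t (n + j) ≠ 0 := by
  have hm1 : (1 : ℝ) ≤ m := by exact_mod_cast hm
  have hq1 : 1 < q := by linarith
  have hq0 : 0 < q := by linarith
  have hε : 0 < 1 - q * (1 - m / (q - 1)) := sub_pos.2 (mul_lt_one_of_lt_qc hq hqc)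
  have hlim : Tendsto (fun L : ℕ => (m / (q - 1)) / q ^ L) atTop (𝓝 0) :=
    tendsto_const_nhds.div_atTop (tendsto_pow_atTop_atTop_of_one_lt hq1)
  -- With this `L`, a run of `L` zeros after a nonzero digit would make the tail smaller than `1 -
  -- qθ`.
  obtain ⟨L, hL⟩ := (hlim.eventually_lt_const hε).exists
  refine ⟨L, fun t h => ?_⟩
  by_cases hex : ∃ n, |val q fun i => t (i + n)| < 1 - m / (q - 1)
  · obtain ⟨n₁, hn₁⟩ := hex
    have hsmall : ∀ n, n₁ ≤ n → |val q fun i => t (i + n)| < 1 - m / (q - 1) := by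
      intro n hn
      induction n, hn using Nat.le_induction with
      | base => exact hn₁
      | succ n _ ih => exact (h.tail_step hm hq hqc ih).1
    have hnext : ∀ n, n₁ ≤ n → t n ≠ 0 → ∃ j < L, t (n + 1 + j) ≠ 0 := by
      intro n hn hne
      by_contra! hzero
      have h1 := (h.tail_step hm hq hqc (hsmall n hn)).2 hne
      rw [val_eq_sum_add hq1 (c := fun i => t (i + (n + 1))) (fun i => h.1 _) L,
        Finset.sum_eq_zero fun i hi => by
          rw [add_comm i, hzero i (Finset.mem_range.1 hi)]; simp, zero_add, abs_div,
        abs_of_pos (pow_pos hq0 L)] at h1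
      have h2 : |val q fun i => t (i + L + (n + 1))| / q ^ L ≤ (m / (q - 1)) / q ^ L := by
        gcongr
        exact abs_val_le hq1 fun i => h.1 _
      linarith
    by_cases hz : ∀ i, n₁ ≤ i → t i = 0
    · exact Or.inl ⟨n₁, hz⟩
    · push Not at hz
      obtain ⟨n₂, hn₂, hne⟩ := hz
      refine Or.inr ⟨n₂, fun n hn => ?_⟩
      induction n, hn using Nat.le_induction with
      | base => exact ⟨0, Nat.zero_le _, hne⟩
      | succ n hn ih =>
        obtain ⟨j, hj, hne⟩ := ih
        rcases Nat.eq_zero_or_pos j with rfl | hj0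
        · obtain ⟨j', hj', hne'⟩ := hnext n (hn₂.trans hn) hne
          exact ⟨j', hj'.le, hne'⟩
        · exact ⟨j - 1, by omega, by rwa [show n + 1 + (j - 1) = n + j by omega]⟩
  -- No tail is inside `(-θ, θ)`. A zero digit would put the tail after it there, so every digit is
  -- nonzero.
  · push Not at hex
    refine Or.inr ⟨0, fun n _ => ⟨0, Nat.zero_le _, fun h0 => ?_⟩⟩
    rw [add_zero] at h0
    have hq2 : q ≤ 2 * m + 1 := le_two_mul_add_one hm hq hqc
    have hm1' : (1 : ℤ) ≤ m := by exact_mod_cast hm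
    exact absurd (abs_lt.2 ⟨h.lt_tail hm hq hq2 (n := n) (by omega),
      h.tail_lt hm hq hq2 (n := n) (by omega)⟩) (not_lt.2 (hex (n + 1)))

/-- Nonzero digits with gaps at most `L` lower the dimension by a definite amount. -/
theorem dimH_digitImage_le_of_gap (hm : 1 ≤ m) (hq : 1 < q) (htm : ∀ i, |t i| ≤ (m : ℤ))
    {L n₀ : ℕ} (hL : ∀ n, n₀ ≤ n → ∃ j ≤ L, t (n + j) ≠ 0) :
    dimH (digitImage q m t) ≤ ENNReal.ofReal (Real.log (m + 1) / Real.log q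
      - (Real.log (m + 1) - Real.log m) / ((L + 1) * Real.log q)) := by
  have hm0 : (0 : ℝ) < m := by exact_mod_cast hm
  have hlogq : 0 < Real.log q := Real.log_pos hq
  have hle : ∀ i, (digitSet m (t i)).card ≤ m + 1 := fun i => by
    rw [card_digitSet (htm i)]; omega
  have hblock : ∀ n, n₀ ≤ n →
      ∏ i ∈ Finset.range (L + 1), (digitSet m (t (n + i))).card ≤ (m + 1) ^ L * m := by
    intro n hn
    obtain ⟨j, hj, hne⟩ := hL n hn
    have hjmem : j ∈ Finset.range (L + 1) := Finset.mem_range.2 (by omega)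
    rw [← Finset.prod_erase_mul _ _ hjmem]
    refine Nat.mul_le_mul ?_ ?_
    · refine (Finset.prod_le_pow_card _ _ (m + 1) fun i _ => hle _).trans_eq ?_
      rw [Finset.card_erase_of_mem hjmem, Finset.card_range, Nat.add_sub_cancel]
    · rw [card_digitSet (htm _)]
      omega
  have hprod : ∀ k, ∏ i ∈ Finset.range (n₀ + (L + 1) * k), (digitSet m (t i)).card
      ≤ (m + 1) ^ n₀ * ((m + 1) ^ L * m) ^ k := by
    intro k
    induction k with
    | zero =>
      simpa using Finset.prod_le_pow_card (Finset.range n₀) (fun i => (digitSet m (t i)).card)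
        (m + 1) fun i _ => hle _
    | succ k ih =>
      rw [Nat.mul_succ, ← add_assoc, Finset.prod_range_add, pow_succ, ← mul_assoc]
      exact Nat.mul_le_mul ih (hblock _ (Nat.le_add_right _ _))
  refine (dimH_digitImage_le hq (n₀ := n₀) (L := L + 1) (M := (m + 1) ^ L * m)
    (C := (m + 1 : ℝ) ^ n₀) L.succ_pos (Nat.mul_pos (by positivity) hm)
    fun k => by exact_mod_cast hprod k).trans_eq ?_
  congr 1
  push_cast
  rw [Real.log_mul (by positivity) hm0.ne', Real.log_pow]
  field_simp
  ring

theorem exists_dimSet_inter_Ioo_eq_empty (hm : 1 ≤ m) (hq : m + 1 < q) (hqc : q < qc m) :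
    ∃ δ : ℝ, 0 < δ ∧ dimSet m q ∩
      Set.Ioo (Real.log (m + 1) / Real.log q - δ) (Real.log (m + 1) / Real.log q) = ∅ := by
  have hm1 : (1 : ℝ) ≤ m := by exact_mod_cast hm
  have hq1 : 1 < q := by linarith
  have hlogq : 0 < Real.log q := Real.log_pos hq1
  obtain ⟨L, hL⟩ := exists_gap_bound hm hq hqc
  have hlog : Real.log m < Real.log (m + 1) := Real.log_lt_log (by linarith) (by linarith)
  refine ⟨(Real.log (m + 1) - Real.log m) / ((L + 1) * Real.log q),
    div_pos (by linarith) (by positivity), ?_⟩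
  rw [Set.eq_empty_iff_forall_notMem]
  rintro _ ⟨⟨x, ⟨hx, -⟩, rfl⟩, h1, h2⟩
  obtain ⟨t, ht, rfl⟩ := (mem_uniqueExp_iff hq1).1 hx
  rw [inter_val_eq_digitImage hq1 ht] at h1 h2
  rcases hL t ht with ⟨n, hn⟩ | ⟨n₀, hn₀⟩
  · have h3 := le_dimH_digitImage_of_eventually_zero hq ht.1 hn
    rw [ENNReal.ofReal_le_iff_le_toReal (Real.dimH_ne_top _)] at h3
    linarith
  · have h3 := dimH_digitImage_le_of_gap hm hq1 ht.1 hn₀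
    refine absurd (ENNReal.toReal_le_of_le_ofReal ?_ h3) (not_le.2 h1)
    -- Nonnegativity of the upper bound is needed because `ENNReal.ofReal` truncates negative
    -- numbers to `0`.
    have h4 : (Real.log (m + 1) - Real.log m) / ((L + 1) * Real.log q)
        ≤ Real.log (m + 1) / Real.log q := by
      gcongr
      · exact Real.log_nonneg (by linarith)
      · linarith [Real.log_nonneg hm1]
      · nlinarith [(Nat.cast_nonneg L : (0 : ℝ) ≤ L)]
    linarith

end gap

/-! ### Above the critical base: periodic examples and density -/

theorem val_pos {q : ℝ} {m : ℕ} {c : ℕ → ℤ} (hq : 1 < q) (hc : ∀ i, |c i| ≤ (m : ℤ))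
    (h0 : ∀ i, 0 ≤ c i) {i : ℕ} (hi : 0 < c i) : 0 < val q c := by
  refine (summable_digits hq hc).tsum_pos (fun j => ?_) i ?_
  · have : (0 : ℝ) ≤ c j := by exact_mod_cast h0 j
    positivity
  · have : (0 : ℝ) < c i := by exact_mod_cast hi
    positivity

/-- The digits `0, 1, 0, 1, …, 0, 1, 0, 0, …, 0, 0` with `k` ones at odd places, repeated with
period `2 * n`. -/
def pulse (n k i : ℕ) : ℤ := if i % 2 = 1 ∧ i / 2 % n < k then 1 else 0

/-- The digits `1, -1, 1, -1, …, 1, -1, 0, 0, …, 0, 0` with `k` pairs `1, -1`, repeated with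
period `2 * n`. -/
def alternating (n k i : ℕ) : ℤ := pulse n k (i + 1) - pulse n k i

section alternating

variable {n k : ℕ}

theorem pulse_eq_zero_or_one (i : ℕ) : pulse n k i = 0 ∨ pulse n k i = 1 := by
  unfold pulse
  split_ifs <;> simp

theorem pulse_two_mul (a : ℕ) : pulse n k (2 * a) = 0 := by
  simp [pulse]

theorem pulse_two_mul_add_one (a : ℕ) :
    pulse n k (2 * a + 1) = if a % n < k then 1 else 0 := by
  have h1 : (2 * a + 1) / 2 = a := by omega
  simp [pulse, h1, Nat.add_mod]

theorem pulse_add_period (i : ℕ) : pulse n k (i + 2 * n) = pulse n k i := by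
  have h1 : (i + 2 * n) / 2 = i / 2 + n := by omega
  simp [pulse, h1]

theorem alternating_add_period (i : ℕ) : alternating n k (i + 2 * n) = alternating n k i := by
  rw [alternating, alternating, add_right_comm, pulse_add_period, pulse_add_period]

theorem abs_alternating_le_one (i : ℕ) : |alternating n k i| ≤ 1 := by
  unfold alternating
  rcases pulse_eq_zero_or_one (n := n) (k := k) i with h | h <;>
  rcases pulse_eq_zero_or_one (n := n) (k := k) (i + 1) with h' | h' <;> simp [h, h']

theorem natAbs_alternating_two_mul (a : ℕ) :
    (alternating n k (2 * a)).natAbs = if a % n < k then 1 else 0 := by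
  rw [alternating, pulse_two_mul, pulse_two_mul_add_one]
  split_ifs <;> rfl

theorem natAbs_alternating_two_mul_add_one (a : ℕ) :
    (alternating n k (2 * a + 1)).natAbs = if a % n < k then 1 else 0 := by
  rw [alternating, show 2 * a + 1 + 1 = 2 * (a + 1) by ring, pulse_two_mul, pulse_two_mul_add_one]
  split_ifs <;> rfl

theorem abs_alternating_le {m : ℕ} (hm : 1 ≤ m) (i : ℕ) : |alternating n k i| ≤ (m : ℤ) :=
  (abs_alternating_le_one i).trans (by exact_mod_cast hm)

/-- A tail is `y - x` for consecutive pulse tails with `qx = p + y`, `p ∈ {0, 1}`, so `q(y - x) =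
(q-1)y - p`. Every pulse tail contains a `1` and a `0`, whence `0 < y < 1/(q-1)` strictly and `|y -
x| < 1/q ≤ θ`. -/
theorem isUniqueDigits_alternating {q : ℝ} {m : ℕ} (hm : 1 ≤ m) (hq : qc m ≤ q) (hn : 0 < n)
    (hk : 0 < k) : IsUniqueDigits q m (alternating n k) := by
  have hm1 : (1 : ℝ) ≤ m := by exact_mod_cast hm
  have hmq := add_one_lt_of_qc_le hm hq
  have hq1 : 1 < q := by linarith
  have hq0 : 0 < q := by linarith
  have hθ := one_le_mul_of_qc_le hm hq
  have hpb : ∀ i, |pulse n k i| ≤ ((1 : ℕ) : ℤ) := fun i => by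
    rcases pulse_eq_zero_or_one (n := n) (k := k) i with h | h <;> simp [h]
  have hpos : ∀ j, 0 < val q fun i => pulse n k (i + j) := by
    intro j
    have hj : j ≤ 2 * (n * j) + 1 := by nlinarith
    refine val_pos hq1 (fun i => hpb _) (fun i => ?_) (i := 2 * (n * j) + 1 - j) ?_
    · rcases pulse_eq_zero_or_one (n := n) (k := k) (i + j) with h | h <;> simp [h]
    · rw [Nat.sub_add_cancel hj, pulse_two_mul_add_one]
      simp [hk]
  have hlt : ∀ j, (val q fun i => pulse n k (i + j)) < 1 / (q - 1) := by
    intro j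
    have h1 : val q (fun _ => 1) = 1 / (q - 1) := by
      simpa [val] using (hasSum_const_digit hq1 1).tsum_eq
    rw [← h1, ← sub_pos, ← val_sub (m := 1) hq1 (fun _ => by simp) fun i => hpb _]
    refine val_pos (m := 1) hq1 (fun i => ?_) (fun i => ?_) (i := j) ?_
    · rcases pulse_eq_zero_or_one (n := n) (k := k) (i + j) with h | h <;> simp [h]
    · rcases pulse_eq_zero_or_one (n := n) (k := k) (i + j) with h | h <;> simp [h]
    · rw [← two_mul, pulse_two_mul]
      simp
  refine isUniqueDigits_of_tails hq1 (abs_alternating_le hm) fun j => ?_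
  have h1 : val q (fun i => alternating n k (i + (j + 1)))
      = val q (fun i => pulse n k (i + (j + 2))) - val q fun i => pulse n k (i + (j + 1)) :=
    val_sub hq1 (c := fun i => pulse n k (i + (j + 2))) (fun i => hpb _) fun i => hpb _
  have h2 : val q (fun i => pulse n k (i + (j + 1))) * q
      = pulse n k (j + 1) + val q fun i => pulse n k (i + (j + 2)) := by
    rw [val_eq_head_add hq1 (c := fun i => pulse n k (i + (j + 1))) fun i => hpb _,
      div_mul_cancel₀ _ hq0.ne']
    simp only [zero_add, add_right_comm _ 1 (j + 1), add_assoc, one_add_one_eq_two]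
  have h3 := hpos (j + 2)
  have h4 := hlt (j + 2)
  rw [lt_div_iff₀ (by linarith)] at h4
  rw [h1]
  generalize val q (fun i => pulse n k (i + (j + 2))) = y at *
  generalize val q (fun i => pulse n k (i + (j + 1))) = x at *
  have h5 : |y - x| * q < 1 := by
    have h6 : |y - x| * q = |(y - x) * q| := by rw [abs_mul, abs_of_pos hq0]
    rw [h6, abs_lt, sub_mul, h2]
    rcases pulse_eq_zero_or_one (n := n) (k := k) (j + 1) with h | h <;> rw [h] <;> push_cast <;>
      constructor <;> nlinarith
  nlinarith

theorem prod_range_two_mul {M : Type*} [CommMonoid M] (f : ℕ → M) (n : ℕ) :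
    ∏ i ∈ Finset.range (2 * n), f i = ∏ a ∈ Finset.range n, f (2 * a) * f (2 * a + 1) := by
  induction n with
  | zero => simp
  | succ n ih =>
    rw [Nat.mul_succ, Finset.prod_range_succ, Finset.prod_range_succ, ih, Finset.prod_range_succ,
      mul_assoc]

theorem prod_card_digitSet_alternating {m l : ℕ} (hm : 1 ≤ m) :
    ∏ i ∈ Finset.range (2 * (k + l)), (digitSet m (alternating (k + l) k i)).card
      = m ^ (2 * k) * (m + 1) ^ (2 * l) := by
  simp only [card_digitSet (abs_alternating_le hm _)]
  rw [prod_range_two_mul, Finset.prod_range_add, pow_mul, pow_mul]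
  simp only [natAbs_alternating_two_mul, natAbs_alternating_two_mul_add_one]
  congr 1
  · rw [Finset.prod_congr rfl (g := fun _ => m ^ 2), Finset.prod_const, Finset.card_range]
    intro a ha
    rw [Finset.mem_range] at ha
    rw [Nat.mod_eq_of_lt (by omega), if_pos ha, Nat.add_sub_cancel, sq]
  · rw [Finset.prod_congr rfl (g := fun _ => (m + 1) ^ 2), Finset.prod_const, Finset.card_range]
    intro a ha
    rw [Finset.mem_range] at ha
    rw [Nat.mod_eq_of_lt (by omega), if_neg (by omega), Nat.sub_zero, sq]

theorem mem_dimSet {q : ℝ} {m l : ℕ} (hm : 1 ≤ m) (hq : qc m ≤ q) (hk : 0 < k) :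
    (k * Real.log m + l * Real.log (m + 1)) / ((k + l) * Real.log q) ∈ dimSet m q := by
  have hm0 : (0 : ℝ) < m := by exact_mod_cast hm
  have hm1 : (1 : ℝ) ≤ m := by exact_mod_cast hm
  have hmq := add_one_lt_of_qc_le hm hq
  have hq1 : 1 < q := by linarith
  have hlogq : 0 < Real.log q := Real.log_pos hq1
  have hkl : 0 < 2 * (k + l) := by omega
  have hk0 : (0 : ℝ) < k := by exact_mod_cast hk
  have hu := isUniqueDigits_alternating (n := k + l) (k := k) hm hq (by omega) hk
  refine ⟨val q (alternating (k + l) k), ⟨(mem_uniqueExp_iff hq1).2 ⟨_, hu, rfl⟩, ?_⟩, ?_⟩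
  · rw [inter_val_eq_digitImage hq1 hu]
    exact isSelfSimilar_digitImage hq1 hkl alternating_add_period hu.1
  · rw [inter_val_eq_digitImage hq1 hu,
      dimH_digitImage_of_periodic hmq hkl alternating_add_period hu.1,
      prod_card_digitSet_alternating hm]
    push_cast
    rw [Real.log_mul (by positivity) (by positivity), Real.log_pow, Real.log_pow,
      ENNReal.toReal_ofReal]
    · push_cast
      field_simp
    · have := Real.log_nonneg hm1
      have := Real.log_nonneg (by linarith : (1 : ℝ) ≤ m + 1)
      positivity

theorem Icc_subset_closure_dimSet {q : ℝ} {m : ℕ} (hm : 1 ≤ m) (hq : qc m ≤ q) :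
    Set.Icc (Real.log m / Real.log q) (Real.log (m + 1) / Real.log q) ⊆
      closure (dimSet m q ∩ Set.Icc (Real.log m / Real.log q) (Real.log (m + 1) / Real.log q)) := by
  have hm0 : (0 : ℝ) < m := by exact_mod_cast hm
  have hq1 : 1 < q := by linarith [add_one_lt_of_qc_le hm hq]
  have hlogq : 0 < Real.log q := Real.log_pos hq1
  have hlog : Real.log m < Real.log (m + 1) := Real.log_lt_log hm0 (by linarith)
  have hc : Real.log m / Real.log q < Real.log (m + 1) / Real.log q := by gcongr
  have hmem : ∀ r : ℚ, 0 < r → r < 1 →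
      Real.log (m + 1) / Real.log q
        - r * (Real.log (m + 1) / Real.log q - Real.log m / Real.log q) ∈ dimSet m q := by
    intro r hr0 hr1
    obtain ⟨k, hk⟩ := Int.eq_ofNat_of_zero_le (Rat.num_nonneg.2 hr0.le)
    have hk0 : 0 < k := by
      have := Rat.num_pos.2 hr0
      omega
    have hkd : k ≤ r.den := by
      have := Rat.num_lt_denom_iff.2 hr1
      omega
    obtain ⟨l, hl⟩ := Nat.exists_eq_add_of_le hkd
    have hr : (r : ℝ) = k / (k + l) := by
      rw [Rat.cast_def, hk, hl]
      push_cast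
      rfl
    have hk1 : (0 : ℝ) < k := by exact_mod_cast hk0
    convert mem_dimSet (l := l) hm hq hk0 using 1
    rw [hr]
    field_simp
    ring
  generalize Real.log m / Real.log q = a at *
  generalize Real.log (m + 1) / Real.log q = b at *
  have hba : 0 < b - a := sub_pos.2 hc
  suffices h : Set.Ioo a b ⊆ closure (dimSet m q ∩ Set.Icc a b) by
    have := closure_minimal h isClosed_closure
    rwa [closure_Ioo hc.ne] at this
  intro y hy
  rw [Metric.mem_closure_iff]
  intro ε hε
  have hy1 : (b - y) / (b - a) < 1 := by
    rw [div_lt_one hba]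
    linarith [hy.1]
  have hy0 : 0 < (b - y) / (b - a) := div_pos (by linarith [hy.2]) hba
  -- The target `y` equals `b - r(b - a)` for `r = (b - y)/(b - a)`; a slightly larger rational
  -- below `1` gives an attained value within `ε`.
  obtain ⟨r, hr1, hr2⟩ := exists_rat_btwn
    (lt_min hy1 (lt_add_of_pos_right _ (div_pos hε hba)))
  rw [lt_min_iff] at hr2
  have hr0 : (0 : ℝ) < r := hy0.trans hr1
  refine ⟨_, ⟨hmem r (by exact_mod_cast hr0) (by exact_mod_cast hr2.1), ?_, ?_⟩, ?_⟩
  · nlinarith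
  · nlinarith
  · rw [← add_div, lt_div_iff₀ hba] at hr2
    rw [div_lt_iff₀ hba] at hr1
    rw [Real.dist_eq, abs_lt]
    constructor <;> linarith

end alternating

end CantorIntersection

theorem theorem1p6 (m : ℕ) (hm : 1 ≤ m) :
    (∀ q : ℝ, CantorIntersection.qc m ≤ q →
      Set.Icc (Real.log m / Real.log q) (Real.log (m + 1) / Real.log q) ⊆
        closure (CantorIntersection.dimSet m q ∩
          Set.Icc (Real.log m / Real.log q) (Real.log (m + 1) / Real.log q))) ∧
    (∀ q : ℝ, (m : ℝ) + 1 < q → q < CantorIntersection.qc m →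
      ∃ δ : ℝ, 0 < δ ∧
        CantorIntersection.dimSet m q ∩
          Set.Ioo (Real.log (m + 1) / Real.log q - δ) (Real.log (m + 1) / Real.log q) = ∅) :=
  ⟨fun _ hq => CantorIntersection.Icc_subset_closure_dimSet hm hq,
    fun _ hq hqc => CantorIntersection.exists_dimSet_inter_Ioo_eq_empty hm hq hqc⟩
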